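/- Let $n\ge 2$ be an even integer and let $\pi$ be the dihedral group of order $2n$, with rotation $x$ and reflection $y$, presented by $\langle x,y \mid x^ny^{-2},\ xyxy^{-1},\ y^2\rangle$. Write $r_1,r_2,r_3$ for these relators, regarded as elements of the free group $F$ on $x,y$, and let $\phi\colon F\to\pi$ be the canonical surjection, extended to $\mathbb{Z}F\to\mathbb{Z}\pi$. Let $d_2\colon \mathbb{Z}\pi^3\to\mathbb{Z}\pi^2$ be the homomorphism of left $\mathbb{Z}\pi$-modules that sends the $k$-th basis vector to $\bigl(\phi(\partial r_k/\partial x),\,\phi(\partial r_k/\partial y)\bigr)$, where $\partial/\partial x,\partial/\partial y\colon\mathbb{Z}F\to\mathbb{Z}F$ are the Fox derivatives, and put $J=\ker(d_2)$. For an abelian group $A$ let $\Gamma(A)$ be Whitehead's quadratic functor: the abelian group with generators $v(a)$, $a\in A$, and relations $v(-a)=v(a)$ and $v(a+b+c)-v(b+c)-v(c+a)-v(a+b)+v(a)+v(b)+v(c)=0$ for $a,b,c\in A$. If $A$ is a $\mathbb{Z}\pi$-module, then $\pi$ acts on $\Gamma(A)$ by $g\cdot v(a)=v(ga)$. For a $\mathbb{Z}\pi$-module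 $M$ let $\widehat H_0(\pi;M)$ be the kernel of the norm map $\mathbb{Z}\otimes_{\mathbb{Z}\pi}M\to M^{\pi}$, $1\otimes m\mapsto\sum_{g\in\pi}gm$. Then $\widehat H_0(\pi;\Gamma(J))=0$, and $\mathbb{Z}\otimes_{\mathbb{Z}\pi}\Gamma(J)$ is torsion-free as an abelian group. -/

import Mathlib

noncomputable section

/-! ### Whitehead's quadratic functor -/

/-- The relators `v(-a) - v(a)` and
`v(a+b+c) - v(b+c) - v(c+a) - v(a+b) + v(a) + v(b) + v(c)` of Whitehead's `Γ(A)`. -/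
def whiteheadRelators (A : Type*) [AddCommGroup A] : Set (FreeAbelianGroup A) :=
  Set.range (fun a : A => FreeAbelianGroup.of (-a) - FreeAbelianGroup.of a) ∪
  Set.range (fun t : A × A × A =>
    FreeAbelianGroup.of (t.1 + t.2.1 + t.2.2) - FreeAbelianGroup.of (t.2.1 + t.2.2)
      - FreeAbelianGroup.of (t.2.2 + t.1) - FreeAbelianGroup.of (t.1 + t.2.1)
      + FreeAbelianGroup.of t.1 + FreeAbelianGroup.of t.2.1 + FreeAbelianGroup.of t.2.2)

/-- Whitehead's `Γ(A)`: the abelian group generated by symbols `v(a)`, `a ∈ A`, subject to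
the relators above. -/
def WhiteheadGamma (A : Type*) [AddCommGroup A] : Type _ :=
  FreeAbelianGroup A ⧸ AddSubgroup.closure (whiteheadRelators A)

namespace WhiteheadGamma

instance (A : Type*) [AddCommGroup A] : AddCommGroup (WhiteheadGamma A) :=
  inferInstanceAs (AddCommGroup (FreeAbelianGroup A ⧸ AddSubgroup.closure (whiteheadRelators A)))

/-- The class of the generator `v(a)`. -/
def v {A : Type*} [AddCommGroup A] (a : A) : WhiteheadGamma A :=
  QuotientAddGroup.mk' (AddSubgroup.closure (whiteheadRelators A)) (FreeAbelianGroup.of a)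

theorem hom_ext {A B : Type*} [AddCommGroup A] [AddCommGroup B]
    {f g : WhiteheadGamma A →+ B} (h : ∀ a, f (v a) = g (v a)) : f = g := by
  apply QuotientAddGroup.addMonoidHom_ext
  apply FreeAbelianGroup.lift_ext
  exact h

/-- The homomorphism `Γ(A) → Γ(B)`, `v(a) ↦ v(f a)`, induced by `f : A → B`. -/
def map {A B : Type*} [AddCommGroup A] [AddCommGroup B] (f : A →+ B) :
    WhiteheadGamma A →+ WhiteheadGamma B :=
  QuotientAddGroup.map _ _ (FreeAbelianGroup.map f) <| by
    rw [AddSubgroup.closure_le]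
    rintro _ (⟨a, rfl⟩ | ⟨⟨a, b, c⟩, rfl⟩) <;>
      refine AddSubgroup.subset_closure ?_
    · exact Or.inl ⟨f a, by simp⟩
    · exact Or.inr ⟨(f a, f b, f c), by simp⟩

@[simp]
theorem map_v {A B : Type*} [AddCommGroup A] [AddCommGroup B] (f : A →+ B) (a : A) :
    map f (v a) = v (f a) := rfl

/-- For a `ℤG`-module `A`, the action of `G` on `Γ(A)` given by `g • v(a) = v(g • a)`. -/
def rep (G : Type*) [Group G] (A : Type*) [AddCommGroup A] [Module (MonoidAlgebra ℤ G) A] :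
    Representation ℤ G (WhiteheadGamma A) where
  toFun g := (map (DistribSMul.toAddMonoidHom A (MonoidAlgebra.of ℤ G g))).toIntLinearMap
  map_one' := LinearMap.ext fun z => DFunLike.congr_fun
    (hom_ext (f := map (DistribSMul.toAddMonoidHom A (MonoidAlgebra.of ℤ G 1)))
      (g := AddMonoidHom.id _) fun a => by simp [-MonoidAlgebra.of_apply]) z
  map_mul' g h := LinearMap.ext fun z => DFunLike.congr_fun
    (hom_ext (f := map (DistribSMul.toAddMonoidHom A (MonoidAlgebra.of ℤ G (g * h))))
      (g := (map (DistribSMul.toAddMonoidHom A (MonoidAlgebra.of ℤ G g))).comp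
        (map (DistribSMul.toAddMonoidHom A (MonoidAlgebra.of ℤ G h))))
      fun a => by simp [-MonoidAlgebra.of_apply, mul_smul]) z

theorem rep_v {G : Type*} [Group G] {A : Type*} [AddCommGroup A]
    [Module (MonoidAlgebra ℤ G) A] (g : G) (a : A) :
    rep G A g (v a) = v (MonoidAlgebra.of ℤ G g • a) := rfl

end WhiteheadGamma

/-! ### Tate homology in degree zero -/

/-- The norm map `N : A_G → A^G`, `[a] ↦ ∑ g, g • a`, from coinvariants to invariants. -/
def coinvariantsNorm {G V : Type*} [Group G] [Fintype G] [AddCommGroup V]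
    (ρ : Representation ℤ G V) : ρ.Coinvariants →ₗ[ℤ] ρ.invariants :=
  Representation.Coinvariants.lift ρ
    (ρ.norm.codRestrict ρ.invariants fun a g => ρ.self_norm_apply g a)
    fun g => LinearMap.ext fun a => Subtype.ext (ρ.norm_self_apply g a)

/-- The Tate homology group `Ĥ₀(G; A)`: the kernel of the norm map `A_G → A^G`. -/
abbrev tateHomologyZero {G V : Type*} [Group G] [Fintype G] [AddCommGroup V]
    (ρ : Representation ℤ G V) : Submodule ℤ ρ.Coinvariants :=
  LinearMap.ker (coinvariantsNorm ρ)

/-! ### Fox derivatives -/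

section Fox

variable {ι : Type*} [DecidableEq ι]

/-- Left multiplication of a free group `F` on the additive group of `ℤF`. -/
def freeGroupAct (ι : Type*) :
    FreeGroup ι →* MulAut (Multiplicative (MonoidAlgebra ℤ (FreeGroup ι))) :=
  (MulAutMultiplicative (MonoidAlgebra ℤ (FreeGroup ι))).symm.toMonoidHom.comp
    ((DistribMulAction.toAddAut (MonoidAlgebra ℤ (FreeGroup ι))ˣ _).comp
      (MonoidAlgebra.of ℤ (FreeGroup ι)).toHomUnits)

/-- The homomorphism `w ↦ (∂w/∂gᵢ, w)` from `F` to `ℤF ⋊ F`, determined by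
`gⱼ ↦ (δᵢⱼ, gⱼ)`; the multiplication `(a, u) (b, w) = (a + u b, u w)` is the product rule. -/
def foxHom (i : ι) :
    FreeGroup ι →* Multiplicative (MonoidAlgebra ℤ (FreeGroup ι)) ⋊[freeGroupAct ι] FreeGroup ι :=
  FreeGroup.lift fun j =>
    ⟨Multiplicative.ofAdd (if i = j then 1 else 0), FreeGroup.of j⟩

/-- The Fox derivative `∂w/∂gᵢ` of an element `w` of the free group. -/
def foxWord (i : ι) (w : FreeGroup ι) : MonoidAlgebra ℤ (FreeGroup ι) :=
  (foxHom i w).left.toAdd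

/-- The Fox derivative `∂/∂gᵢ : ℤF → ℤF`, the `ℤ`-linear extension. -/
def foxDeriv (i : ι) : MonoidAlgebra ℤ (FreeGroup ι) →+ MonoidAlgebra ℤ (FreeGroup ι) :=
  MonoidAlgebra.liftNC (Int.castAddHom _) (foxWord i)

theorem foxDeriv_of (i : ι) (w : FreeGroup ι) :
    foxDeriv i (MonoidAlgebra.of ℤ _ w) = foxWord i w := by
  simp [foxDeriv]

theorem foxWord_gen (i j : ι) : foxWord i (FreeGroup.of j) = if i = j then 1 else 0 := by
  simp [foxWord, foxHom]

theorem foxWord_one (i : ι) : foxWord i 1 = 0 := by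
  simp [foxWord]

theorem foxWord_mul (i : ι) (u w : FreeGroup ι) :
    foxWord i (u * w) = foxWord i u + MonoidAlgebra.of ℤ _ u * foxWord i w := by
  have h : ∀ u : FreeGroup ι, (foxHom i u).right = u := fun u => by
    have : (SemidirectProduct.rightHom.comp (foxHom i)) = MonoidHom.id _ :=
      FreeGroup.ext_hom _ _ fun j => by simp [foxHom]
    exact DFunLike.congr_fun this u
  simp only [foxWord, map_mul, SemidirectProduct.mul_left, h, toAdd_mul]
  rfl

/-- For `φ : F → G` and relators `r`, the matrix with entries `φ(∂rₖ/∂gᵢ) ∈ ℤG`. -/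
def foxMatrix {κ G : Type*} [Group G] (φ : FreeGroup ι →* G) (r : κ → FreeGroup ι) :
    Matrix κ ι (MonoidAlgebra ℤ G) :=
  Matrix.of fun k i => MonoidAlgebra.mapDomainRingHom ℤ φ
    (foxDeriv i (MonoidAlgebra.of ℤ _ (r k)))

/-- The left `ℤG`-linear differential `d₂ : ℤG^κ → ℤG^ι` with
`d₂(rₖ) = ∑ᵢ φ(∂rₖ/∂gᵢ) gᵢ`: right multiplication of row vectors by the Fox matrix. -/
def foxD₂ {κ G : Type*} [Fintype κ] [Group G] (φ : FreeGroup ι →* G) (r : κ → FreeGroup ι) :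
    (κ → MonoidAlgebra ℤ G) →ₗ[MonoidAlgebra ℤ G] (ι → MonoidAlgebra ℤ G) :=
  (foxMatrix φ r).vecMulLinear

end Fox

/-! ### The presentation of the dihedral group -/

/-- The relators `xⁿy⁻²`, `xyxy⁻¹`, `y²` in the free group on `x = g₀`, `y = g₁`. -/
def dihedralRelators (n : ℕ) : Fin 3 → FreeGroup (Fin 2) :=
  let x := FreeGroup.of (0 : Fin 2)
  let y := FreeGroup.of (1 : Fin 2)
  ![x ^ n * y ^ (-2 : ℤ), x * y * x * y⁻¹, y ^ 2]

/-- The surjection from the free group to the dihedral group of order `2n` sending `x` to the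
rotation `r 1` and `y` to the reflection `sr 0`. -/
def dihedralPresMap (n : ℕ) : FreeGroup (Fin 2) →* DihedralGroup n :=
  FreeGroup.lift ![DihedralGroup.r 1, DihedralGroup.sr 0]

/-- The left `ℤπ`-module `ker d₂ ⊆ ℤπ³`, where `π` is the dihedral group of order `2n`. -/
abbrev dihedralKer (n : ℕ) :
    Submodule (MonoidAlgebra ℤ (DihedralGroup n)) (Fin 3 → MonoidAlgebra ℤ (DihedralGroup n)) :=
  LinearMap.ker (foxD₂ (dihedralPresMap n) (dihedralRelators n))

end

/-! Write `xy = sr (-1)` and let `N` be the sum of the rotations. After a change of coordinates `J`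
is the set of triples `(a, b, c)` with `aN = b(1+y) = c(1+xy)`, generated by `α = (x-1, 0, 0)`, `β =
(0, 1-y, 0)`, `γ = (0, 0, 1-xy)` and `δ = (1+y, N, N)`; modulo the first three, `δ` is needed only
with integer coefficients.

Each pair of coordinates `f, f'` gives a hermitian form `v(a) ↦ f(a)* f'(a)`, which descends to the
coinvariants of `Γ(J)` with values in the torsion-free group `ℤπ`. The key point is that these forms
jointly detect zero (`eq_zero_of_form_eq_zero`), so the coinvariants are torsion-free. The Tate
group then vanishes, being killed by the order of `π`.

For detection, a class is written as an integral combination of `v` of the generators and their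
pairings `⟨u, w⟩ = v(u+w) - v(u) - v(w)`. Vanishing of the forms gives linear equations on the
coefficients. The relations `Nα = 0`, `yβ = -β`, `xyγ = -γ` and the formulas for `xδ`, `yδ` then
cancel every term. Some cancellations need a coefficient to be even; evaluating an equation at the
rotation of order two, which exists as `n` is even, supplies this. -/

noncomputable section

/-! ### Quadratic maps out of Γ -/

namespace WhiteheadGamma

section Universal

variable {A B : Type*} [AddCommGroup A] [AddCommGroup B]

/-- The homomorphism out of `Γ(A)` induced by a quadratic map. -/
def lift (Q : A → B) (hneg : ∀ a, Q (-a) = Q a)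
    (hadd : ∀ a b c, Q (a + b + c) - Q (b + c) - Q (c + a) - Q (a + b) + Q a + Q b + Q c = 0) :
    WhiteheadGamma A →+ B :=
  QuotientAddGroup.lift _ (FreeAbelianGroup.lift Q) <| by
    rw [AddSubgroup.closure_le]
    rintro _ (⟨a, rfl⟩ | ⟨⟨a, b, c⟩, rfl⟩)
    · simp [AddMonoidHom.mem_ker, hneg]
    · simpa [AddMonoidHom.mem_ker] using hadd a b c

theorem lift_v (Q : A → B) (hneg) (hadd) (a : A) : lift Q hneg hadd (v a) = Q a := by
  change FreeAbelianGroup.lift Q (FreeAbelianGroup.of a) = Q a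
  simp

theorem v_neg (a : A) : v (-a) = v a := by
  rw [← sub_eq_zero]
  exact (QuotientAddGroup.eq_zero_iff _).2 (AddSubgroup.subset_closure (Or.inl ⟨a, rfl⟩))

theorem v_add_add (a b c : A) :
    v (a + b + c) - v (b + c) - v (c + a) - v (a + b) + v a + v b + v c = 0 :=
  (QuotientAddGroup.eq_zero_iff _).2 (AddSubgroup.subset_closure (Or.inr ⟨(a, b, c), rfl⟩))

theorem v_zero : v (0 : A) = 0 := by
  simpa using v_add_add (0 : A) 0 0

theorem closure_range_v : AddSubgroup.closure (Set.range (v : A → WhiteheadGamma A)) = ⊤ := by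
  rw [eq_top_iff]
  rintro z -
  induction z using QuotientAddGroup.induction_on with
  | H z =>
    induction z using FreeAbelianGroup.induction_on with
    | zero => exact zero_mem _
    | of a => exact AddSubgroup.subset_closure ⟨a, rfl⟩
    | neg a ih => exact neg_mem ih
    | add a b ha hb => exact add_mem ha hb

end Universal

end WhiteheadGamma

/-! ### The involution of the group ring and Tate homology -/

/-- The anti-automorphism `∑ a_g g ↦ ∑ a_g g⁻¹` of the group ring `ℤG`. -/
def groupRingConj (G : Type*) [Group G] : MonoidAlgebra ℤ G →+ MonoidAlgebra ℤ G :=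
  MonoidAlgebra.liftNC (Int.castAddHom _) fun g => MonoidAlgebra.of ℤ G g⁻¹

section Conj

variable {G : Type*} [Group G]

theorem groupRingConj_single (g : G) (a : ℤ) :
    groupRingConj G (MonoidAlgebra.single g a) = MonoidAlgebra.single g⁻¹ a := by
  simp [groupRingConj, MonoidAlgebra.liftNC_single, MonoidAlgebra.intCast_def,
    MonoidAlgebra.single_mul_single]

theorem groupRingConj_one : groupRingConj G 1 = 1 := by
  rw [MonoidAlgebra.one_def, groupRingConj_single, inv_one]

theorem groupRingConj_mul (p q : MonoidAlgebra ℤ G) :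
    groupRingConj G (p * q) = groupRingConj G q * groupRingConj G p := by
  induction p using MonoidAlgebra.induction_linear with
  | zero => simp
  | add p p' hp hp' => simp [add_mul, mul_add, hp, hp']
  | single g a =>
    induction q using MonoidAlgebra.induction_linear with
    | zero => simp
    | add q q' hq hq' => simp [add_mul, mul_add, hq, hq']
    | single h b => simp [groupRingConj_single, MonoidAlgebra.single_mul_single, mul_comm]

end Conj

/-- In the coinvariants every summand of the norm of `a` becomes the class of `a`, so a vanishing
norm makes that class torsion, of order dividing `|G|`. -/
theorem tateHomologyZero_eq_bot {G V : Type*} [Group G] [Fintype G] [AddCommGroup V]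
    (ρ : Representation ℤ G V) [IsAddTorsionFree ρ.Coinvariants] : tateHomologyZero ρ = ⊥ := by
  rw [eq_bot_iff]
  intro z hz
  induction z using Representation.Coinvariants.induction_on with
  | _ a =>
    have h : ∑ g, ρ g a = 0 := by
      have h0 : ρ.norm a = 0 := congrArg Subtype.val (LinearMap.mem_ker.1 hz)
      simpa [Representation.norm] using h0
    have h2 : Fintype.card G • Representation.Coinvariants.mk ρ a = 0 := by
      have h3 := congrArg (Representation.Coinvariants.mk ρ) h
      simpa [map_sum, Representation.Coinvariants.mk_self_apply] using h3
    rw [Submodule.mem_bot]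
    exact (nsmul_eq_zero_iff.1 h2).resolve_right Fintype.card_ne_zero

/-! ### Pairings and hermitian forms on the coinvariants -/

namespace WhiteheadGamma

section Coinvariants

variable {G A : Type*} [Group G] [AddCommGroup A] [Module (MonoidAlgebra ℤ G) A]

variable (G A) in
/-- The group `ℤ ⊗_{ℤG} Γ(A)`. -/
abbrev Coinv : Type _ := (rep G A).Coinvariants

variable (G) in
/-- The class of `v(a)` in the coinvariants of `Γ(A)`. -/
def cv (a : A) : Coinv G A := Representation.Coinvariants.mk _ (v a)

theorem cv_neg (a : A) : cv G (-a) = cv G a := by rw [cv, v_neg, cv]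

theorem cv_zero : cv G (0 : A) = 0 := by rw [cv, v_zero, map_zero]

theorem cv_add_add (a b c : A) : cv G (a + b + c) - cv G (b + c) - cv G (c + a) - cv G (a + b)
    + cv G a + cv G b + cv G c = 0 := by
  simp only [cv, ← map_sub, ← map_add, v_add_add, map_zero]

theorem cv_smul (g : G) (a : A) : cv G (MonoidAlgebra.of ℤ G g • a) = cv G a := by
  rw [cv, ← rep_v]
  exact Representation.Coinvariants.mk_self_apply _ g (v a)

variable (G) in
/-- The bilinear pairing `⟨a, b⟩ = v(a + b) - v(a) - v(b)` with values in the coinvariants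
of `Γ(A)`. -/
def cb : A →+ A →+ Coinv G A :=
  AddMonoidHom.mk' (fun a => AddMonoidHom.mk' (fun b => cv G (a + b) - cv G a - cv G b)
    fun b c => by
      have h := cv_add_add (G := G) a b c
      rw [add_comm c a] at h
      rw [← add_assoc, ← sub_eq_zero, ← h]; abel)
    fun a b => AddMonoidHom.ext fun c => by
      have h := cv_add_add (G := G) a b c
      rw [add_comm c a] at h
      simp only [AddMonoidHom.mk'_apply, AddMonoidHom.add_apply]
      rw [← sub_eq_zero, ← h]; abel

theorem cb_apply (a b : A) : cb G a b = cv G (a + b) - cv G a - cv G b := rfl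

theorem cv_add (a b : A) : cv G (a + b) = cv G a + cv G b + cb G a b := by
  rw [cb_apply]; abel

theorem cb_comm (a b : A) : cb G a b = cb G b a := by
  rw [cb_apply, cb_apply, add_comm b]; abel

/-- Bilinearity turns `⟨a, a⟩` into `-⟨a, -a⟩`, and `v(0) = 0`, `v(-a) = v(a)` do the rest. -/
theorem cb_self (a : A) : cb G a a = (2 : ℤ) • cv G a := by
  have h := map_neg (cb G a) a
  rw [cb_apply a (-a), add_neg_cancel, cv_zero, cv_neg] at h
  rw [← neg_inj, ← h, two_zsmul]; abel

theorem cb_of_smul (g : G) (a b : A) :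
    cb G (MonoidAlgebra.of ℤ G g • a) (MonoidAlgebra.of ℤ G g • b) = cb G a b := by
  rw [cb_apply, ← smul_add, cv_smul, cv_smul, cv_smul, cb_apply]

theorem zsmul_single_one_smul (g : G) (k : ℤ) (a : A) :
    (MonoidAlgebra.single g k : MonoidAlgebra ℤ G) • a = k • (MonoidAlgebra.of ℤ G g • a) := by
  rw [← smul_assoc, MonoidAlgebra.of_apply, MonoidAlgebra.smul_single, smul_eq_mul, mul_one]

/-- The pairing is `G`-invariant, so a group element crosses it as its inverse; linearity extends
this to the group ring. -/
theorem cb_smul_left (p : MonoidAlgebra ℤ G) (a b : A) :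
    cb G (p • a) b = cb G a (groupRingConj G p • b) := by
  induction p using MonoidAlgebra.induction_linear with
  | zero => simp
  | add p p' hp hp' => simp [add_smul, hp, hp']
  | single g k =>
    rw [groupRingConj_single, zsmul_single_one_smul, zsmul_single_one_smul, map_zsmul, map_zsmul,
      ← cb_of_smul g a, ← mul_smul, ← map_mul, mul_inv_cancel, map_one, one_smul]
    rfl

theorem closure_range_cv : AddSubgroup.closure (Set.range (cv G : A → Coinv G A)) = ⊤ := by
  rw [eq_top_iff]
  rintro z -
  induction z using Representation.Coinvariants.induction_on with
  | _ w =>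
    have hw : w ∈ AddSubgroup.closure (Set.range (v : A → WhiteheadGamma A)) := by
      rw [closure_range_v]; trivial
    induction hw using AddSubgroup.closure_induction with
    | mem x hx =>
      obtain ⟨a, rfl⟩ := hx
      exact AddSubgroup.subset_closure ⟨a, rfl⟩
    | zero => rw [map_zero]; exact zero_mem _
    | add x y _ _ hx hy => rw [map_add]; exact add_mem hx hy
    | neg x _ hx => rw [map_neg]; exact neg_mem hx

/-- The homomorphism on `Γ(A)` with `v(a) ↦ f(a)* f'(a)`. -/
def preform (f f' : A →ₗ[MonoidAlgebra ℤ G] MonoidAlgebra ℤ G) :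
    WhiteheadGamma A →+ MonoidAlgebra ℤ G :=
  lift (fun a => groupRingConj G (f a) * f' a) (fun a => by simp)
    (fun a b c => by simp only [map_add, add_mul, mul_add]; abel)

theorem preform_v (f f' : A →ₗ[MonoidAlgebra ℤ G] MonoidAlgebra ℤ G) (a : A) :
    preform f f' (v a) = groupRingConj G (f a) * f' a := by
  rw [preform, lift_v]

/-- The involution produces `g⁻¹` next to `g`, and they cancel. -/
theorem preform_rep (f f' : A →ₗ[MonoidAlgebra ℤ G] MonoidAlgebra ℤ G) (g : G) :
    (preform f f').comp (rep G A g).toAddMonoidHom = preform f f' := hom_ext fun a => by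
  simp only [AddMonoidHom.comp_apply, LinearMap.toAddMonoidHom_coe, rep_v, preform_v,
    map_smul, smul_eq_mul, groupRingConj_mul, MonoidAlgebra.of_apply, groupRingConj_single]
  rw [mul_assoc, ← mul_assoc (MonoidAlgebra.single _ _) _ (f' a),
    MonoidAlgebra.single_mul_single, inv_mul_cancel, one_mul, ← MonoidAlgebra.one_def, one_mul]

/-- The homomorphism on the coinvariants of `Γ(A)` with `v(a) ↦ f(a)* f'(a)`. -/
def form (f f' : A →ₗ[MonoidAlgebra ℤ G] MonoidAlgebra ℤ G) :
    Coinv G A →+ MonoidAlgebra ℤ G :=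
  (Representation.Coinvariants.lift _ (preform f f').toIntLinearMap
    fun g => LinearMap.ext fun z => DFunLike.congr_fun (preform_rep f f' g) z).toAddMonoidHom

theorem form_cv (f f' : A →ₗ[MonoidAlgebra ℤ G] MonoidAlgebra ℤ G) (a : A) :
    form f f' (cv G a) = groupRingConj G (f a) * f' a := by
  rw [← preform_v]
  rfl

theorem form_cb (f f' : A →ₗ[MonoidAlgebra ℤ G] MonoidAlgebra ℤ G) (a b : A) :
    form f f' (cb G a b) = groupRingConj G (f a) * f' b + groupRingConj G (f b) * f' a := by
  simp only [cb_apply, map_sub, form_cv, map_add, mul_add, add_mul]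
  abel

/-- If `A` is generated by `d` as an abelian group together with the `sᵢ` as a `ℤG`-module, this
describes generators of the coinvariants of `Γ(A)`. -/
theorem exists_eq_sum {ι : Type*} [Fintype ι] [DecidableEq ι] (s : ι → A) (d : A)
    (hs : ∀ a : A, ∃ (k : ℤ) (p : ι → MonoidAlgebra ℤ G), a = k • d + ∑ i, p i • s i)
    (z : Coinv G A) : ∃ (m₀ : ℤ) (m k : ι → ℤ) (p : ι → ι → MonoidAlgebra ℤ G),
      z = m₀ • cv G d + ∑ i, m i • cv G (s i) + ∑ i, k i • cb G (s i) d +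
        ∑ i, ∑ j, cb G (s i) (p i j • s j) := by
  let S : AddSubgroup (Coinv G A) :=
    { carrier := {z | ∃ (m₀ : ℤ) (m k : ι → ℤ) (p : ι → ι → MonoidAlgebra ℤ G),
        z = m₀ • cv G d + ∑ i, m i • cv G (s i) + ∑ i, k i • cb G (s i) d +
          ∑ i, ∑ j, cb G (s i) (p i j • s j)}
      zero_mem' := ⟨0, 0, 0, 0, by simp⟩
      add_mem' := by
        rintro _ _ ⟨m₀, m, k, p, rfl⟩ ⟨m₀', m', k', p', rfl⟩
        refine ⟨m₀ + m₀', m + m', k + k', p + p', ?_⟩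
        simp only [Pi.add_apply, add_smul, map_add, Finset.sum_add_distrib]
        abel
      neg_mem' := by
        rintro _ ⟨m₀, m, k, p, rfl⟩
        refine ⟨-m₀, -m, -k, -p, ?_⟩
        simp only [Pi.neg_apply, neg_smul, map_neg, Finset.sum_neg_distrib]
        abel }
  have hd : cv G d ∈ S := ⟨1, 0, 0, 0, by simp⟩
  have hcv (i) : cv G (s i) ∈ S := ⟨0, Pi.single i 1, 0, 0, by
    simp [Pi.single_apply, ite_smul]⟩
  have hsd (i) : cb G (s i) d ∈ S := ⟨0, 0, Pi.single i 1, 0, by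
    simp [Pi.single_apply, ite_smul]⟩
  have hss (i j) (p : MonoidAlgebra ℤ G) : cb G (s i) (p • s j) ∈ S :=
    ⟨0, 0, 0, Pi.single i (Pi.single j p), by
      simp [Pi.single_apply, ite_smul, ite_apply, apply_ite]⟩
  have h1 (i) (a : A) : cb G (s i) a ∈ S := by
    obtain ⟨k, p, rfl⟩ := hs a
    rw [map_add, map_zsmul, map_sum]
    exact add_mem (zsmul_mem (hsd i) k) (sum_mem fun j _ => hss i j _)
  have h2 (i) (p : MonoidAlgebra ℤ G) (a : A) : cb G (p • s i) a ∈ S := by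
    rw [cb_smul_left]; exact h1 i _
  have h3 (a : A) : cb G a d ∈ S := by
    obtain ⟨k, p, rfl⟩ := hs a
    rw [map_add, map_zsmul, map_sum, AddMonoidHom.add_apply, AddMonoidHom.finsetSum_apply,
      AddMonoidHom.coe_smul, Pi.smul_apply, cb_self]
    exact add_mem (zsmul_mem (zsmul_mem hd 2) k) (sum_mem fun j _ => h2 _ _ _)
  have h4 (a b : A) : cb G a b ∈ S := by
    obtain ⟨k, p, rfl⟩ := hs a
    rw [map_add, map_zsmul, map_sum, AddMonoidHom.add_apply, AddMonoidHom.finsetSum_apply,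
      AddMonoidHom.coe_smul, Pi.smul_apply, cb_comm]
    exact add_mem (zsmul_mem (h3 b) k) (sum_mem fun j _ => h2 _ _ _)
  -- `U` is closed under addition because `v(a+b)` differs from `v(a) + v(b)` by a pairing, and all
  -- pairings lie in `S` by `h4`.
  let U : AddSubgroup A :=
    { carrier := {a | cv G a ∈ S}
      zero_mem' := by
        change cv G (0 : A) ∈ S
        rw [cv_zero]; exact zero_mem _
      add_mem' := fun {a b} ha hb => by
        change cv G (a + b) ∈ S
        rw [cv_add]; exact add_mem (add_mem ha hb) (h4 a b)
      neg_mem' := fun {a} ha => by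
        change cv G (-a) ∈ S
        rw [cv_neg]; exact ha }
  have h5 (p : MonoidAlgebra ℤ G) (i) : p • s i ∈ U := by
    induction p using MonoidAlgebra.induction_linear with
    | zero => rw [zero_smul]; exact zero_mem _
    | add p p' hp hp' => rw [add_smul]; exact add_mem hp hp'
    | single g k =>
      rw [zsmul_single_one_smul]
      refine zsmul_mem ?_ k
      change cv G _ ∈ S
      rw [cv_smul]; exact hcv i
  have h6 : AddSubgroup.closure (Set.range (cv G : A → Coinv G A)) ≤ S := by
    rw [AddSubgroup.closure_le]
    rintro _ ⟨a, rfl⟩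
    obtain ⟨k, p, rfl⟩ := hs a
    exact add_mem (zsmul_mem (show d ∈ U from hd) k) (sum_mem fun i _ => h5 _ _)
  rw [closure_range_cv] at h6
  exact h6 (AddSubgroup.mem_top z)

end Coinvariants

end WhiteheadGamma

open DihedralGroup

/-! ### Sequences on ℤ/n -/

section Sequences

variable {n : ℕ} [NeZero n]

theorem ZMod.apply_eq_of_apply_add_one {B : Type*} {c : ZMod n → B} (h : ∀ k, c (k + 1) = c k)
    (k l : ZMod n) : c k = c l := by
  have key : ∀ k, c k = c 0 := fun k => by
    rw [← ZMod.natCast_zmod_val k]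
    induction k.val with
    | zero => simp
    | succ m ih => rw [Nat.cast_succ, h, ih]
  rw [key k, key l]

/-- The first difference is constant and sums to zero around the cycle, so `n` times it vanishes. -/
theorem ZMod.apply_eq_of_second_difference {c : ZMod n → ℤ}
    (h : ∀ k, 2 * c k - c (k + 1) - c (k - 1) = 0) (k l : ZMod n) : c k = c l := by
  have h1 : ∀ k l, c (k + 1) - c k = c (l + 1) - c l :=
    ZMod.apply_eq_of_apply_add_one fun k => by
      have := h (k + 1)
      rw [add_sub_cancel_right] at this
      linarith
  have h2 : ∑ k, (c (k + 1) - c k) = 0 := by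
    rw [Finset.sum_sub_distrib, sub_eq_zero]
    exact Fintype.sum_equiv (Equiv.addRight 1) _ _ fun k => rfl
  rw [Finset.sum_congr rfl fun k _ => h1 k 0, Finset.sum_const, Finset.card_univ, ZMod.card,
    nsmul_eq_mul, mul_eq_zero] at h2
  refine ZMod.apply_eq_of_apply_add_one (fun k => ?_) k l
  have h3 := h1 k 0
  rw [h2.resolve_left (Nat.cast_ne_zero.2 (NeZero.ne n))] at h3
  linarith

/-- Terms cancel in pairs; at a fixed point `2 c i = 0`. -/
theorem sum_smul_eq_zero_of_involution {ι C : Type*} [Fintype ι] [AddCommGroup C]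
    (τ : ι → ι) (hτ : ∀ i, τ (τ i) = i) (c : ι → ℤ) (Y : ι → C) (hc : ∀ i, c i + c (τ i) = 0)
    (hY : ∀ i, Y (τ i) = Y i) : ∑ i, c i • Y i = 0 :=
  Finset.sum_involution (fun i _ => τ i)
    (fun i _ => by rw [hY, ← add_smul, hc, zero_smul])
    (fun i _ h heq => h <| by
      have := hc i
      rw [heq] at this
      rw [show c i = 0 by omega, zero_smul])
    (fun i _ => Finset.mem_univ _) (fun i _ => hτ i)

end Sequences

/-! ### The group ring of the dihedral group -/

section GroupRing

variable {n : ℕ} [NeZero n]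

/-- The element `∑ cᵢ xⁱ` of the group ring of the dihedral group. -/
def rotPoly : (ZMod n → ℤ) →+ MonoidAlgebra ℤ (DihedralGroup n) :=
  AddMonoidHom.mk' (fun c => ∑ i, MonoidAlgebra.single (r i) (c i)) fun c d => by
    simp [Finset.sum_add_distrib]

/-- The reflection `sr j` as an element of the group ring. -/
def reflElt (j : ZMod n) : MonoidAlgebra ℤ (DihedralGroup n) := MonoidAlgebra.single (sr j) 1

/-- The rotation `r i` as an element of the group ring. -/
def rotElt (i : ZMod n) : MonoidAlgebra ℤ (DihedralGroup n) := MonoidAlgebra.single (r i) 1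

/-- The indicator function of `0`. -/
def ind (k : ZMod n) : ℤ := if k = 0 then 1 else 0

omit [NeZero n] in
theorem ind_zero : ind (0 : ZMod n) = 1 := if_pos rfl

omit [NeZero n] in
theorem ind_of_ne {k : ZMod n} (h : k ≠ 0) : ind k = 0 := if_neg h

omit [NeZero n] in
theorem ind_neg (k : ZMod n) : ind (-k) = ind k := by simp [ind]

theorem rotPoly_apply (c : ZMod n → ℤ) : rotPoly c = ∑ i, MonoidAlgebra.single (r i) (c i) := rfl

@[simp]
theorem coeff_rotPoly_r (c : ZMod n → ℤ) (k : ZMod n) : (rotPoly c).coeff (r k) = c k := by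
  simp [rotPoly_apply, MonoidAlgebra.coeff_single, Finsupp.single_apply]

@[simp]
theorem coeff_rotPoly_sr (c : ZMod n → ℤ) (k : ZMod n) : (rotPoly c).coeff (sr k) = 0 := by
  simp [rotPoly_apply, MonoidAlgebra.coeff_single]

section Coefficients

omit [NeZero n]

@[simp]
theorem coeff_rotElt_r (i k : ZMod n) : (rotElt i).coeff (r k) = ind (k - i) := by
  simp [rotElt, MonoidAlgebra.coeff_single, Finsupp.single_apply, ind, sub_eq_zero, eq_comm]

@[simp]
theorem coeff_rotElt_sr (i k : ZMod n) : (rotElt i).coeff (sr k) = 0 := by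
  simp [rotElt, MonoidAlgebra.coeff_single]

@[simp]
theorem coeff_reflElt_r (i k : ZMod n) : (reflElt i).coeff (r k) = 0 := by
  simp [reflElt, MonoidAlgebra.coeff_single]

@[simp]
theorem coeff_reflElt_sr (i k : ZMod n) : (reflElt i).coeff (sr k) = ind (k - i) := by
  simp [reflElt, MonoidAlgebra.coeff_single, Finsupp.single_apply, ind, sub_eq_zero, eq_comm]

theorem rotElt_zero : rotElt (0 : ZMod n) = 1 := rfl

theorem coeff_one_r (k : ZMod n) :
    (1 : MonoidAlgebra ℤ (DihedralGroup n)).coeff (r k) = ind k := by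
  rw [← rotElt_zero, coeff_rotElt_r, sub_zero]

theorem coeff_one_sr (k : ZMod n) :
    (1 : MonoidAlgebra ℤ (DihedralGroup n)).coeff (sr k) = 0 :=
  coeff_rotElt_sr 0 k

theorem dihedralGroupRing_ext {p q : MonoidAlgebra ℤ (DihedralGroup n)}
    (hr : ∀ k, p.coeff (r k) = q.coeff (r k)) (hsr : ∀ k, p.coeff (sr k) = q.coeff (sr k)) :
    p = q := by
  ext g
  rcases g with k | k
  exacts [hr k, hsr k]

variable (p : MonoidAlgebra ℤ (DihedralGroup n)) (i k : ZMod n)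

@[simp]
theorem coeff_rotElt_mul_r : (rotElt i * p).coeff (r k) = p.coeff (r (k - i)) := by
  simp [rotElt, sub_eq_neg_add]

@[simp]
theorem coeff_rotElt_mul_sr : (rotElt i * p).coeff (sr k) = p.coeff (sr (k + i)) := by
  simp [rotElt]

@[simp]
theorem coeff_reflElt_mul_r : (reflElt i * p).coeff (r k) = p.coeff (sr (i + k)) := by
  simp [reflElt]

@[simp]
theorem coeff_reflElt_mul_sr : (reflElt i * p).coeff (sr k) = p.coeff (r (k - i)) := by
  simp [reflElt]

@[simp]
theorem coeff_mul_rotElt_r : (p * rotElt i).coeff (r k) = p.coeff (r (k - i)) := by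
  simp [rotElt, sub_eq_add_neg]

@[simp]
theorem coeff_mul_rotElt_sr : (p * rotElt i).coeff (sr k) = p.coeff (sr (k - i)) := by
  simp [rotElt, sub_eq_add_neg]

@[simp]
theorem coeff_mul_reflElt_r : (p * reflElt i).coeff (r k) = p.coeff (sr (i - k)) := by
  simp [reflElt]

@[simp]
theorem coeff_mul_reflElt_sr : (p * reflElt i).coeff (sr k) = p.coeff (r (i - k)) := by
  simp [reflElt]

end Coefficients

theorem rotPoly_ind : rotPoly (ind (n := n)) = 1 :=
  dihedralGroupRing_ext (fun k => by rw [coeff_rotPoly_r, coeff_one_r])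
    (fun k => by rw [coeff_rotPoly_sr, coeff_one_sr])

theorem exists_eq_rotPoly_add (j : ZMod n) (p : MonoidAlgebra ℤ (DihedralGroup n)) :
    ∃ c d : ZMod n → ℤ, p = rotPoly c + rotPoly d * reflElt j :=
  ⟨fun k => p.coeff (r k), fun k => p.coeff (sr (j - k)),
    dihedralGroupRing_ext (fun k => by simp) (fun k => by simp)⟩

theorem groupRingConj_rotPoly (c : ZMod n → ℤ) :
    groupRingConj _ (rotPoly c) = rotPoly fun k => c (-k) := by
  rw [rotPoly_apply, rotPoly_apply, map_sum]
  refine Fintype.sum_equiv (Equiv.neg _) _ _ fun k => ?_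
  simp [groupRingConj_single]

omit [NeZero n] in
theorem groupRingConj_reflElt (j : ZMod n) : groupRingConj _ (reflElt j) = reflElt j := by
  simp [reflElt, groupRingConj_single]

omit [NeZero n] in
theorem groupRingConj_rotElt (j : ZMod n) : groupRingConj _ (rotElt j) = rotElt (-j) := by
  simp [rotElt, groupRingConj_single]

variable (n) in
/-- The norm element `∑ xⁱ` of the rotation subgroup. -/
abbrev rotNorm : MonoidAlgebra ℤ (DihedralGroup n) := rotPoly (n := n) fun _ => 1

theorem groupRingConj_rotNorm : groupRingConj _ (rotNorm n) = rotNorm n :=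
  groupRingConj_rotPoly _

theorem rotPoly_const (k : ℤ) : rotPoly (n := n) (fun _ => k) = k • rotNorm n := by
  rw [← map_zsmul]; congr 1; ext; simp

omit [NeZero n] in
theorem reflElt_mul_reflElt (i j : ZMod n) : reflElt i * reflElt j = rotElt (j - i) := by
  simp [reflElt, rotElt, MonoidAlgebra.single_mul_single]

omit [NeZero n] in
theorem rotElt_mul_rotElt (i j : ZMod n) : rotElt i * rotElt j = rotElt (i + j) := by
  simp [rotElt, MonoidAlgebra.single_mul_single]

omit [NeZero n] in
theorem rotElt_mul_reflElt (i j : ZMod n) : rotElt i * reflElt j = reflElt (j - i) := by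
  simp [reflElt, rotElt, MonoidAlgebra.single_mul_single]

omit [NeZero n] in
theorem reflElt_mul_rotElt (i j : ZMod n) : reflElt j * rotElt i = reflElt (j + i) := by
  simp [reflElt, rotElt, MonoidAlgebra.single_mul_single]

theorem rotElt_mul_rotNorm (i : ZMod n) : rotElt i * rotNorm n = rotNorm n :=
  dihedralGroupRing_ext (fun k => by simp) (fun k => by simp)

theorem rotNorm_mul_rotElt (i : ZMod n) : rotNorm n * rotElt i = rotNorm n :=
  dihedralGroupRing_ext (fun k => by simp) (fun k => by simp)

end GroupRing

/-! ### Cancellation between pairings -/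

namespace WhiteheadGamma

section Elimination

variable {n : ℕ} [NeZero n] {A : Type*} [AddCommGroup A]
  [Module (MonoidAlgebra ℤ (DihedralGroup n)) A]

theorem cb_rotPoly_smul (c : ZMod n → ℤ) (u w : A) :
    cb (DihedralGroup n) u (rotPoly c • w) =
      ∑ i, c i • cb (DihedralGroup n) u (rotElt i • w) := by
  rw [rotPoly_apply, Finset.sum_smul, map_sum]
  refine Finset.sum_congr rfl fun i _ => ?_
  rw [zsmul_single_one_smul, map_zsmul]
  rfl

/-- By invariance and symmetry `⟨u, xᵏu⟩ = ⟨u, x⁻ᵏu⟩`, so the terms with `k ≠ 0` cancel; the term `k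
= 0` is absorbed by `⟨u, u⟩ = 2v(u)`. -/
theorem cv_add_cb_self_eq_zero (m : ℤ) (c : ZMod n → ℤ) (u : A)
    (h : ∀ k, m * ind k + c k + c (-k) = 0) :
    m • cv (DihedralGroup n) u + cb (DihedralGroup n) u (rotPoly c • u) = 0 := by
  have hm : m = -(c 0 * 2) := by have := h 0; rw [ind_zero, neg_zero] at this; linarith
  have h1 : rotPoly c • u = c 0 • u + rotPoly (c - c 0 • ind) • u := by
    rw [map_sub, map_zsmul, rotPoly_ind, sub_smul, smul_assoc, one_smul]; abel
  rw [h1, map_add, map_zsmul, cb_self, hm, cb_rotPoly_smul,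
    sum_smul_eq_zero_of_involution (fun k => -k) (fun k => neg_neg k)]
  · rw [smul_smul, neg_smul, add_zero, neg_add_cancel]
  · intro k
    have := h k
    simp only [Pi.sub_apply, Pi.smul_apply, smul_eq_mul, ind_neg]
    rw [hm] at this
    linarith
  · intro k
    rw [cb_comm, cb_smul_left, groupRingConj_rotElt, neg_neg]

/-- The two sign changes cancel, giving `⟨u, xᵏw⟩ = ⟨u, x^(j-i-k) w⟩`. -/
theorem cb_eq_zero_of_refl (i j : ZMod n) (e : ZMod n → ℤ) (u w : A) (hu : reflElt i • u = -u)
    (hw : reflElt j • w = -w) (he : ∀ k, e k + e (j - i - k) = 0) :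
    cb (DihedralGroup n) u (rotPoly e • w) = 0 := by
  rw [cb_rotPoly_smul]
  refine sum_smul_eq_zero_of_involution (fun k => j - i - k) (fun k => by ring) _ _ he fun k => ?_
  calc cb (DihedralGroup n) u (rotElt (j - i - k) • w)
      = cb (DihedralGroup n) (-(reflElt i • u)) (rotElt (j - i - k) • w) := by rw [hu, neg_neg]
    _ = cb (DihedralGroup n) u (rotElt k • -(reflElt j • w)) := by
      rw [map_neg, AddMonoidHom.neg_apply, cb_smul_left, groupRingConj_reflElt, smul_neg, map_neg,
        smul_smul, smul_smul, reflElt_mul_rotElt, rotElt_mul_reflElt]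
      congr 4; ring
    _ = cb (DihedralGroup n) u (rotElt k • w) := by rw [hw, neg_neg]

end Elimination

end WhiteheadGamma

/-! ### The pullback module, its relations and a normal form -/

/-- A presentation of a `ℤπ`-module `A`, `π` the dihedral group of order `2n`, as a pullback
`{(a, b, c) : a N = b (1 + y) = c (1 + xy)}`, with its four standard generators. -/
structure DihedralPullback (n : ℕ) [NeZero n] (A : Type*) [AddCommGroup A]
    [Module (MonoidAlgebra ℤ (DihedralGroup n)) A] where
  (fα fβ fγ : A →ₗ[MonoidAlgebra ℤ (DihedralGroup n)] MonoidAlgebra ℤ (DihedralGroup n))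
  (α β γ δ : A)
  fα_α : fα α = rotElt 1 - 1
  fα_β : fα β = 0
  fα_γ : fα γ = 0
  fα_δ : fα δ = 1 + reflElt 0
  fβ_α : fβ α = 0
  fβ_β : fβ β = 1 - reflElt 0
  fβ_γ : fβ γ = 0
  fβ_δ : fβ δ = rotNorm n
  fγ_α : fγ α = 0
  fγ_β : fγ β = 0
  fγ_γ : fγ γ = 1 - reflElt (-1)
  fγ_δ : fγ δ = rotNorm n
  ext_fα_fβ_fγ : ∀ u w, fα u = fα w → fβ u = fβ w → fγ u = fγ w → u = w
  exists_eq : ∀ u, ∃ (k : ℤ) (p q s : MonoidAlgebra ℤ (DihedralGroup n)),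
    u = k • δ + (p • α + q • β + s • γ)

namespace DihedralPullback

open WhiteheadGamma

variable {n : ℕ} [NeZero n] {A : Type*} [AddCommGroup A]
  [Module (MonoidAlgebra ℤ (DihedralGroup n)) A] (P : DihedralPullback n A)

include P

theorem rotNorm_smul_α : rotNorm n • P.α = 0 := by
  apply P.ext_fα_fβ_fγ <;>
  simp [P.fα_α, P.fβ_α, P.fγ_α, mul_sub, rotNorm_mul_rotElt]

theorem reflElt_smul_β : reflElt (0 : ZMod n) • P.β = -P.β := by
  apply P.ext_fα_fβ_fγ <;>
  simp [P.fα_β, P.fβ_β, P.fγ_β, mul_sub, reflElt_mul_reflElt, rotElt_zero]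

theorem reflElt_smul_γ : reflElt (-1 : ZMod n) • P.γ = -P.γ := by
  apply P.ext_fα_fβ_fγ <;>
  simp [P.fα_γ, P.fβ_γ, P.fγ_γ, mul_sub, reflElt_mul_reflElt, rotElt_zero]

/-- Only the first coordinate moves, and `(x-1)(1+y) = (x-1) - xy(x-1)`. -/
theorem rotElt_smul_δ : rotElt (1 : ZMod n) • P.δ = P.δ + P.α - reflElt (-1 : ZMod n) • P.α := by
  apply P.ext_fα_fβ_fγ <;>
  simp [P.fα_α, P.fβ_α, P.fγ_α, P.fα_δ, P.fβ_δ, P.fγ_δ, mul_sub, mul_add, reflElt_mul_rotElt,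
    rotElt_mul_reflElt, rotElt_mul_rotNorm]
  abel

theorem reflElt_smul_δ :
    reflElt (0 : ZMod n) • P.δ = P.δ - rotNorm n • P.β - rotNorm n • P.γ := by
  apply P.ext_fα_fβ_fγ
  · simp [P.fα_β, P.fα_γ, P.fα_δ, mul_add, reflElt_mul_reflElt, rotElt_zero, add_comm]
  · simp only [map_sub, map_smul, smul_eq_mul, P.fβ_δ, P.fβ_β, P.fβ_γ]
    exact dihedralGroupRing_ext (fun k => by simp [mul_sub]) (fun k => by simp [mul_sub])
  · simp only [map_sub, map_smul, smul_eq_mul, P.fγ_δ, P.fγ_β, P.fγ_γ]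
    exact dihedralGroupRing_ext (fun k => by simp [mul_sub]) (fun k => by simp [mul_sub])

/-- The element `δ - xyα = (1+xy, N, N)` is the mirror image of `δ`, with `xy` in the role of `y`.
This is why the normal form pairs it, rather than `δ`, with `γ`. -/
theorem reflElt_smul_δ' : reflElt (-1 : ZMod n) • (P.δ - reflElt (-1 : ZMod n) • P.α) =
    P.δ - reflElt (-1 : ZMod n) • P.α - rotNorm n • P.β - rotNorm n • P.γ := by
  have h := congrArg (fun u => rotElt (1 : ZMod n) • u) P.reflElt_smul_δ
  simp only [smul_sub, smul_smul, rotElt_mul_reflElt, rotElt_mul_rotNorm, P.rotElt_smul_δ,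
    zero_sub] at h
  rw [smul_sub, smul_smul, reflElt_mul_reflElt, sub_self, rotElt_zero, one_smul, h]
  abel

theorem exists_smul_β (p : MonoidAlgebra ℤ (DihedralGroup n)) :
    ∃ c : ZMod n → ℤ, p • P.β = rotPoly c • P.β := by
  obtain ⟨c, d, rfl⟩ := exists_eq_rotPoly_add 0 p
  refine ⟨c - d, ?_⟩
  rw [add_smul, mul_smul, P.reflElt_smul_β, map_sub, sub_smul, smul_neg, sub_eq_add_neg]

theorem exists_smul_γ (p : MonoidAlgebra ℤ (DihedralGroup n)) :
    ∃ c : ZMod n → ℤ, p • P.γ = rotPoly c • P.γ := by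
  obtain ⟨c, d, rfl⟩ := exists_eq_rotPoly_add (-1) p
  refine ⟨c - d, ?_⟩
  rw [add_smul, mul_smul, P.reflElt_smul_γ, map_sub, sub_smul, smul_neg, sub_eq_add_neg]

/-- The normal form of an element of `ℤ ⊗ Γ(A)`. -/
def normalForm (m₀ m₁ m₂ m₃ k₁ k₂ k₃ : ℤ) (a b c d e f g : ZMod n → ℤ) :
    Coinv (DihedralGroup n) A :=
  m₀ • cv (DihedralGroup n) P.δ + m₁ • cv _ P.α + m₂ • cv _ P.β + m₃ • cv _ P.γ +
    k₁ • cb _ P.α P.δ + k₂ • cb _ P.β P.δ + k₃ • cb _ P.γ (P.δ - reflElt (-1 : ZMod n) • P.α) +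
    cb _ P.α (rotPoly a • P.α) + cb _ P.α ((rotPoly b * reflElt 0) • P.α) +
    cb _ P.β (rotPoly c • P.β) + cb _ P.γ (rotPoly d • P.γ) + cb _ P.β (rotPoly e • P.γ) +
    cb _ P.α (rotPoly f • P.β) + cb _ P.α (rotPoly g • P.γ)

theorem exists_eq_normalForm (z : Coinv (DihedralGroup n) A) :
    ∃ m₀ m₁ m₂ m₃ k₁ k₂ k₃ a b c d e f g,
      z = P.normalForm m₀ m₁ m₂ m₃ k₁ k₂ k₃ a b c d e f g := by
  obtain ⟨m₀, m, k, p, rfl⟩ := WhiteheadGamma.exists_eq_sum ![P.α, P.β, P.γ] P.δ (fun u => by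
    obtain ⟨k, p, q, s, rfl⟩ := P.exists_eq u
    exact ⟨k, ![p, q, s], by simp [Fin.sum_univ_three]⟩) z
  obtain ⟨a, b, h00⟩ := exists_eq_rotPoly_add 0 (p 0 0)
  obtain ⟨c, h11⟩ := P.exists_smul_β (p 1 1)
  obtain ⟨d, h22⟩ := P.exists_smul_γ (p 2 2)
  -- For distinct generators the two orders of pairing are merged by moving the coefficient across.
  obtain ⟨e, h12⟩ := P.exists_smul_γ (p 1 2 + groupRingConj _ (p 2 1))
  obtain ⟨f, h01⟩ := P.exists_smul_β (p 0 1 + groupRingConj _ (p 1 0))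
  -- The last summand compensates for replacing `δ` by `δ - xyα` in the pairing with `γ`.
  obtain ⟨g, h02⟩ := P.exists_smul_γ
    (p 0 2 + groupRingConj _ (p 2 0) + k 2 • groupRingConj _ (reflElt (-1)))
  refine ⟨m₀, m 0, m 1, m 2, k 0, k 1, k 2, a, b, c, d, e, f, g, ?_⟩
  have hswap (u w : A) (q : MonoidAlgebra ℤ (DihedralGroup n)) :
      cb (DihedralGroup n) w (q • u) = cb _ u (groupRingConj _ q • w) := by
    rw [cb_comm, cb_smul_left]
  simp only [normalForm, Fin.sum_univ_three, Matrix.cons_val_zero, Matrix.cons_val_one,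
    Matrix.cons_val, ← h11, ← h22, ← h12, ← h01, ← h02, h00, add_smul, map_add, map_sub,
    hswap P.α P.β, hswap P.α P.γ, hswap P.β P.γ, smul_assoc, map_zsmul, smul_sub]
  abel

end DihedralPullback

/-! ### Coefficient equations from the forms -/

namespace DihedralPullback

open WhiteheadGamma

variable {n : ℕ} [NeZero n] {A : Type*} [AddCommGroup A]
  [Module (MonoidAlgebra ℤ (DihedralGroup n)) A] (P : DihedralPullback n A)
  {m₀ m₁ m₂ m₃ k₁ k₂ k₃ : ℤ} {a b c d e f g : ZMod n → ℤ}

omit [NeZero n] in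
theorem augmentation_rotElt (j : ZMod n) :
    MonoidAlgebra.lift ℤ ℤ (DihedralGroup n) 1 (rotElt j) = 1 := by
  simp [rotElt]

omit [NeZero n] in
theorem augmentation_reflElt (j : ZMod n) :
    MonoidAlgebra.lift ℤ ℤ (DihedralGroup n) 1 (reflElt j) = 1 := by
  simp [reflElt]

/-- Composed with augmentation, `fα` kills `α, β, γ` and sends `δ` to 2, leaving `4 m₀ = 0`. -/
theorem normalForm_m₀ (h : form P.fα P.fα
    (P.normalForm m₀ m₁ m₂ m₃ k₁ k₂ k₃ a b c d e f g) = 0) : m₀ = 0 := by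
  have h1 := congrArg (MonoidAlgebra.lift ℤ ℤ (DihedralGroup n) 1) h
  simp only [normalForm, map_add, map_sub, map_zsmul, form_cv, form_cb, map_smul, P.fα_α, P.fα_β,
    P.fα_γ, P.fα_δ, smul_eq_mul, map_mul, groupRingConj_mul, groupRingConj_one,
    groupRingConj_rotElt, groupRingConj_reflElt, augmentation_rotElt, augmentation_reflElt, map_one,
    map_zero] at h1
  norm_num at h1
  exact h1

/-- Only `(x⁻¹-1) f (1-y)` survives, since `(x⁻¹-1)N = 0` and `(1+y)(1-y) = 0`. -/
theorem normalForm_coeff_αβ (h : form P.fα P.fβ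
    (P.normalForm 0 m₁ m₂ m₃ k₁ k₂ k₃ a b c d e f g) = 0) (k : ZMod n) : f (k + 1) = f k := by
  have h1 := congrArg (fun p => p.coeff (r k)) h
  simp [normalForm, form_cv, form_cb, P.fα_α, P.fα_β, P.fα_γ, P.fα_δ, P.fβ_α, P.fβ_β, P.fβ_γ,
    P.fβ_δ, groupRingConj_mul, groupRingConj_one, groupRingConj_rotElt, groupRingConj_reflElt,
    groupRingConj_rotPoly, mul_sub, sub_mul, add_mul, reflElt_mul_reflElt, rotElt_zero, coeff_one_r,
    -zsmul_eq_mul] at h1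
  linarith

theorem normalForm_coeff_αγ (h : form P.fα P.fγ
    (P.normalForm 0 m₁ m₂ m₃ k₁ k₂ k₃ a b c d e f g) = 0) (k : ZMod n) : g (k + 1) = g k := by
  have h1 := congrArg (fun p => p.coeff (r k)) h
  simp [normalForm, form_cv, form_cb, P.fα_α, P.fα_β, P.fα_γ, P.fα_δ, P.fγ_α, P.fγ_β, P.fγ_γ,
    P.fγ_δ, groupRingConj_mul, groupRingConj_one, groupRingConj_rotElt, groupRingConj_reflElt,
    groupRingConj_rotPoly, mul_sub, sub_mul, add_mul, reflElt_mul_reflElt, rotElt_zero, coeff_one_r,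
    -zsmul_eq_mul] at h1
  linarith

/-- The index `-1 - k` comes from `y xⁱ xy = x^(-1-i)`; the constants `k₂, k₃` are coefficients of
`(1-y)N` and `N(1-xy)`. -/
theorem normalForm_coeff_βγ (h : form P.fβ P.fγ
    (P.normalForm 0 m₁ m₂ m₃ k₁ k₂ k₃ a b c d e f g) = 0) (k : ZMod n) :
    e k + e (-1 - k) + k₂ + k₃ = 0 := by
  have h1 := congrArg (fun p => p.coeff (r k)) h
  simp [normalForm, form_cv, form_cb, P.fβ_α, P.fβ_β, P.fβ_γ, P.fβ_δ, P.fγ_α, P.fγ_β, P.fγ_γ,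
    P.fγ_δ, groupRingConj_mul, groupRingConj_one, groupRingConj_reflElt, groupRingConj_rotPoly,
    mul_sub, sub_mul, -zsmul_eq_mul] at h1
  linarith

theorem normalForm_coeff_ββ (h : form P.fβ P.fβ
    (P.normalForm 0 m₁ m₂ m₃ k₁ k₂ k₃ a b c d e f g) = 0) (k : ZMod n) :
    m₂ * ind k + c k + c (-k) + k₂ = 0 := by
  have h1 := congrArg (fun p => p.coeff (r k)) h
  simp [normalForm, form_cv, form_cb, P.fβ_α, P.fβ_β, P.fβ_γ, P.fβ_δ, groupRingConj_mul,
    groupRingConj_one, groupRingConj_reflElt, groupRingConj_rotPoly, mul_sub, sub_mul, mul_add,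
    reflElt_mul_reflElt, rotElt_zero, coeff_one_r, -zsmul_eq_mul] at h1
  linarith

theorem normalForm_coeff_γγ (h : form P.fγ P.fγ
    (P.normalForm 0 m₁ m₂ m₃ k₁ k₂ k₃ a b c d e f g) = 0) (k : ZMod n) :
    m₃ * ind k + d k + d (-k) + k₃ = 0 := by
  have h1 := congrArg (fun p => p.coeff (r k)) h
  simp [normalForm, form_cv, form_cb, P.fγ_α, P.fγ_β, P.fγ_γ, P.fγ_δ, groupRingConj_mul,
    groupRingConj_one, groupRingConj_reflElt, groupRingConj_rotPoly, mul_sub, sub_mul, mul_add,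
    reflElt_mul_reflElt, rotElt_zero, coeff_one_r, -zsmul_eq_mul] at h1
  linarith

/-- The second difference is multiplication by `(x⁻¹-1)(x-1) = 2 - x - x⁻¹`. -/
theorem normalForm_coeff_αα_r (h : form P.fα P.fα
    (P.normalForm 0 m₁ m₂ m₃ k₁ k₂ k₃ a b c d e f g) = 0) (k : ZMod n) :
    2 * (m₁ * ind k + a k + a (-k) - k₁ * ind k) -
      (m₁ * ind (k + 1) + a (k + 1) + a (-(k + 1)) - k₁ * ind (k + 1)) -
      (m₁ * ind (k - 1) + a (k - 1) + a (-(k - 1)) - k₁ * ind (k - 1)) = 0 := by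
  have h1 := congrArg (fun p => p.coeff (r k)) h
  simp [normalForm, form_cv, form_cb, P.fα_α, P.fα_β, P.fα_γ, P.fα_δ,
    groupRingConj_mul, groupRingConj_one, groupRingConj_rotElt,
    groupRingConj_reflElt, groupRingConj_rotPoly, mul_sub, sub_mul, add_mul, mul_add,
    coeff_one_r, -zsmul_eq_mul] at h1
  ring_nf at h1 ⊢
  linarith

theorem normalForm_coeff_αα_sr (h : form P.fα P.fα
    (P.normalForm 0 m₁ m₂ m₃ k₁ k₂ k₃ a b c d e f g) = 0) (k : ZMod n) :
    b (k + 1 + 1) - b (k + 1) + k₁ * ind (k + 1) = b (k + 1) - b k + k₁ * ind k := by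
  have h1 := congrArg (fun p => p.coeff (sr (-k))) h
  simp [normalForm, form_cv, form_cb, P.fα_α, P.fα_β, P.fα_γ, P.fα_δ,
    groupRingConj_mul, groupRingConj_one, groupRingConj_rotElt,
    groupRingConj_reflElt, groupRingConj_rotPoly, mul_sub, sub_mul, add_mul, mul_add,
    coeff_one_sr,
    -zsmul_eq_mul] at h1
  have h2 : ind (-1 - k) = ind (1 + k) := by rw [← ind_neg]; congr 1; ring
  ring_nf at h1 ⊢
  rw [h2, ind_neg] at h1
  linarith

end DihedralPullback

/-! ### The forms jointly detect zero -/

namespace DihedralPullback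

open WhiteheadGamma

variable {n : ℕ} [NeZero n] {A : Type*} [AddCommGroup A]
  [Module (MonoidAlgebra ℤ (DihedralGroup n)) A] (P : DihedralPullback n A)
  {m₀ m₁ m₂ m₃ k₁ k₂ k₃ : ℤ} {a b c d e f g : ZMod n → ℤ}

omit [NeZero n] in
-- The element `n/2`; evenness of `n` enters the argument only here.
theorem exists_ne_zero_neg_eq (hn : Even n) [NeZero n] : ∃ h : ZMod n, h ≠ 0 ∧ -h = h := by
  obtain ⟨m, rfl⟩ := hn
  have hm : m ≠ 0 := fun h => NeZero.ne (m + m) (by rw [h, add_zero])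
  refine ⟨(m : ZMod (m + m)), fun h => ?_, ?_⟩
  · rw [ZMod.natCast_eq_zero_iff] at h
    have := Nat.le_of_dvd (Nat.pos_of_ne_zero hm) h
    omega
  · rw [neg_eq_iff_add_eq_zero, ← Nat.cast_add, ZMod.natCast_self]

include P

theorem cb_α_const_smul (k : ℤ) (u : A) :
    cb (DihedralGroup n) P.α (rotPoly (fun _ : ZMod n => k) • u) = 0 := by
  rw [rotPoly_const, smul_assoc, map_zsmul, ← groupRingConj_rotNorm (n := n), ← cb_smul_left,
    P.rotNorm_smul_α, map_zero, AddMonoidHom.zero_apply, smul_zero]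

/-- Since `yβ = -β`, `⟨β, δ⟩ = -⟨β, yδ⟩`; expand `yδ`. -/
theorem two_cb_β_δ : (2 : ℤ) • cb (DihedralGroup n) P.β P.δ =
    cb _ P.β (rotNorm n • P.β) + cb _ P.β (rotNorm n • P.γ) := by
  have h : cb (DihedralGroup n) P.β P.δ = -cb _ P.β (reflElt (0 : ZMod n) • P.δ) := by
    rw [← groupRingConj_reflElt (0 : ZMod n), ← cb_smul_left, P.reflElt_smul_β, map_neg,
      AddMonoidHom.neg_apply, neg_neg]
  rw [P.reflElt_smul_δ, map_sub, map_sub] at h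
  rw [two_zsmul]
  nth_rw 1 [h]
  abel

theorem two_cb_γ_δ :
    (2 : ℤ) • cb (DihedralGroup n) P.γ (P.δ - reflElt (-1 : ZMod n) • P.α) =
      cb _ P.γ (rotNorm n • P.γ) + cb _ P.β (rotNorm n • P.γ) := by
  have h : cb (DihedralGroup n) P.γ (P.δ - reflElt (-1 : ZMod n) • P.α) =
      -cb _ P.γ (reflElt (-1 : ZMod n) • (P.δ - reflElt (-1 : ZMod n) • P.α)) := by
    nth_rw 2 [← groupRingConj_reflElt (-1 : ZMod n)]
    rw [← cb_smul_left, P.reflElt_smul_γ, map_neg,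
      AddMonoidHom.neg_apply, neg_neg]
  rw [P.reflElt_smul_δ', map_sub _ _ (rotNorm n • P.γ), map_sub _ _ (rotNorm n • P.β)] at h
  rw [two_zsmul, cb_comm P.β, cb_smul_left, groupRingConj_rotNorm]
  nth_rw 1 [h]
  abel

/-- With `B = ∑ b(i+1) xⁱ` the hypothesis reads `B(1-x) + k = sN`. Apply this to `δ`, pair with `α`
and use `⟨α, Nδ⟩ = 0`. -/
theorem cb_α_δ {k s : ℤ} (h : ∀ i, b (i + 1) - b i + k * ind i = s) :
    k • cb (DihedralGroup n) P.α P.δ + cb _ P.α ((rotPoly b * reflElt 0) • P.α) =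
      cb _ P.α (rotPoly (fun i => b (i + 1)) • P.α) := by
  have h1 : rotPoly (fun _ => s) = rotPoly (fun i => b (i + 1)) - rotPoly b + k • 1 := by
    rw [← rotPoly_ind, ← map_zsmul, ← map_sub, ← map_add]
    congr 1
    ext i
    simp [h]
  have h2 : rotPoly b = rotPoly (fun i => b (i + 1)) * rotElt 1 :=
    dihedralGroupRing_ext (fun k => by simp) (fun k => by simp)
  have h3 : rotPoly (fun i => b (i + 1)) * reflElt (-1) = rotPoly b * reflElt 0 := by
    rw [h2, mul_assoc, rotElt_mul_reflElt, zero_sub]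
  have h4 := P.cb_α_const_smul s P.δ
  rw [h1, add_smul, sub_smul, h2, mul_smul _ (rotElt 1), P.rotElt_smul_δ, smul_sub, smul_add,
    smul_smul _ (reflElt (-1)), h3, smul_assoc, one_smul, map_add, map_sub, map_sub, map_add,
    map_zsmul] at h4
  rw [← sub_eq_zero, ← h4]
  abel

theorem eq_zero_of_form_eq_zero (hn : Even n) (z : Coinv (DihedralGroup n) A)
    (hz : ∀ f f', form f f' z = 0) : z = 0 := by
  obtain ⟨m₀, m₁, m₂, m₃, k₁, k₂, k₃, a, b, c, d, e, f, g, rfl⟩ := P.exists_eq_normalForm z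
  obtain ⟨h, h0, hh⟩ := exists_ne_zero_neg_eq hn
  obtain rfl := P.normalForm_m₀ (hz _ _)
  have hf := ZMod.apply_eq_of_apply_add_one (P.normalForm_coeff_αβ (hz _ _))
  have hg := ZMod.apply_eq_of_apply_add_one (P.normalForm_coeff_αγ (hz _ _))
  have hββ := P.normalForm_coeff_ββ (hz _ _)
  have hγγ := P.normalForm_coeff_γγ (hz _ _)
  have hβγ := P.normalForm_coeff_βγ (hz _ _)
  have hαα := ZMod.apply_eq_of_second_difference
    (c := fun k => m₁ * ind k + a k + a (-k) - k₁ * ind k) (P.normalForm_coeff_αα_r (hz _ _))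
  have hαα' := ZMod.apply_eq_of_apply_add_one (c := fun k => b (k + 1) - b k + k₁ * ind k)
    (P.normalForm_coeff_αα_sr (hz _ _))
  -- At `h = -h ≠ 0` the equation reads `2c(h) + k₂ = 0`. Evenness matters because only `2⟨β, δ⟩` is
  -- expressed through other pairings.
  obtain ⟨l₂, rfl⟩ : ∃ l, k₂ = l * 2 := ⟨-c h, by
    have := hββ h
    rw [hh, ind_of_ne h0] at this
    linarith⟩
  obtain ⟨l₃, rfl⟩ : ∃ l, k₃ = l * 2 := ⟨-d h, by
    have := hγγ h
    rw [hh, ind_of_ne h0] at this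
    linarith⟩
  have zf : cb (DihedralGroup n) P.α (rotPoly f • P.β) = 0 := by
    rw [show f = fun _ => f 0 from funext fun k => hf k 0]
    exact P.cb_α_const_smul (f 0) _
  have zg : cb (DihedralGroup n) P.α (rotPoly g • P.γ) = 0 := by
    rw [show g = fun _ => g 0 from funext fun k => hg k 0]
    exact P.cb_α_const_smul _ _
  have zc := cv_add_cb_self_eq_zero m₂ (c + fun _ => l₂) P.β fun k => by
    simp only [Pi.add_apply]; linarith [hββ k]
  have zd := cv_add_cb_self_eq_zero m₃ (d + fun _ => l₃) P.γ fun k => by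
    simp only [Pi.add_apply]; linarith [hγγ k]
  have ze := cb_eq_zero_of_refl 0 (-1) (e + fun _ => l₂ + l₃) P.β P.γ P.reflElt_smul_β
    P.reflElt_smul_γ fun k => by
      simp only [Pi.add_apply, sub_zero]; linarith [hβγ k]
  have hconst : ∀ k l, m₁ * ind k + (a k + b (k + 1)) + (a (-k) + b (-k + 1)) =
      m₁ * ind l + (a l + b (l + 1)) + (a (-l) + b (-l + 1)) := by
    refine ZMod.apply_eq_of_apply_add_one fun k => ?_
    have h1 := hαα (k + 1) k
    have h2 := hαα' (k + 1) (-k)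
    rw [ind_neg] at h2
    rw [show -(k + 1) + 1 = -k by ring]
    linarith
  -- The constant is even by evaluation at `h`; half of it is then removed from the coefficients, at
  -- no cost because `Nα = 0`.
  obtain ⟨l₁, hl₁⟩ : ∃ l₁, ∀ k, m₁ * ind k + (a k + b (k + 1)) + (a (-k) + b (-k + 1)) =
      l₁ * 2 := ⟨a h + b (h + 1), fun k => by
    rw [hconst k h, hh, ind_of_ne h0]; ring⟩
  have za := cv_add_cb_self_eq_zero m₁
    (a + (fun k => b (k + 1)) - fun _ => l₁) P.α fun k => by
      simp only [Pi.add_apply, Pi.sub_apply]; linarith [hl₁ k]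
  have zk := P.cb_α_δ (b := b) (k := k₁) fun i => hαα' i 0
  rw [map_sub, map_add, sub_smul, add_smul, map_sub, map_add, P.cb_α_const_smul, ← zk] at za
  rw [map_add, add_smul, map_add, rotPoly_const, smul_assoc, map_zsmul] at zc zd ze
  rw [normalForm, zf, zg, mul_smul, mul_smul, P.two_cb_β_δ, P.two_cb_γ_δ, zero_smul]
  have key := congrArg₂ (· + ·) (congrArg₂ (· + ·) za zc) (congrArg₂ (· + ·) zd ze)
  simp only [add_zero, sub_zero] at key
  refine Eq.trans ?_ key
  rw [smul_add, smul_add, add_smul]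
  abel

theorem isAddTorsionFree_coinv (hn : Even n) : IsAddTorsionFree (Coinv (DihedralGroup n) A) := by
  refine ⟨fun m hm u w huw => sub_eq_zero.1 (P.eq_zero_of_form_eq_zero hn _ fun f f' => ?_)⟩
  have h : m • form f f' (u - w) = 0 := by
    rw [← map_nsmul, smul_sub, sub_eq_zero.2 huw, map_zero]
  ext x
  have hx := congrArg (fun p => p.coeff x) h
  simpa [hm, -nsmul_eq_mul] using hx

end DihedralPullback

/-! ### Fox calculus of inverses and powers -/

section Fox

variable {ι : Type*} [DecidableEq ι]

theorem foxWord_inv (i : ι) (u : FreeGroup ι) :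
    foxWord i u⁻¹ = -(MonoidAlgebra.of ℤ _ u⁻¹ * foxWord i u) := by
  have h := foxWord_mul i u⁻¹ u
  rw [inv_mul_cancel, foxWord_one] at h
  exact eq_neg_of_add_eq_zero_left h.symm

theorem foxWord_pow (i : ι) (u : FreeGroup ι) (m : ℕ) :
    foxWord i (u ^ m) = (∑ j ∈ Finset.range m, MonoidAlgebra.of ℤ _ (u ^ j)) * foxWord i u := by
  induction m with
  | zero => simp [foxWord_one]
  | succ m ih => rw [pow_succ, foxWord_mul, ih, Finset.sum_range_succ, add_mul]

end Fox

/-! ### Annihilators in the group ring -/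

section Division

variable {n : ℕ} [NeZero n]

theorem eq_mul_one_sub_reflElt (j : ZMod n) {p : MonoidAlgebra ℤ (DihedralGroup n)}
    (h : p * (1 + reflElt j) = 0) : ∃ q, p = q * (1 - reflElt j) := by
  obtain ⟨c, d, rfl⟩ := exists_eq_rotPoly_add j p
  refine ⟨rotPoly c, ?_⟩
  have h1 (k) : c k + d k = 0 := by
    have := congrArg (fun p => p.coeff (r k)) h
    simpa [mul_add, add_mul] using this
  rw [show d = -c from funext fun k => by simp only [Pi.neg_apply]; linarith [h1 k], map_neg]
  noncomm_ring

theorem exists_rotElt_sub_one_eq (i : ZMod n) :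
    ∃ q, rotElt i - 1 = q * (rotElt (1 : ZMod n) - 1) := by
  rw [← ZMod.natCast_zmod_val i]
  induction i.val with
  | zero => exact ⟨0, by rw [Nat.cast_zero, rotElt_zero, sub_self, zero_mul]⟩
  | succ m ih =>
    obtain ⟨q, hq⟩ := ih
    refine ⟨rotElt m + q, ?_⟩
    rw [add_mul, ← hq, mul_sub, rotElt_mul_rotElt, mul_one, Nat.cast_succ]
    abel

/-- As the coefficients sum to zero, the element equals `∑ cᵢ (xⁱ - 1)`. -/
theorem exists_rotPoly_eq {c : ZMod n → ℤ} (h : ∑ i, c i = 0) :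
    ∃ q, rotPoly c = q * (rotElt (1 : ZMod n) - 1) := by
  choose q hq using exists_rotElt_sub_one_eq (n := n)
  refine ⟨∑ i, c i • q i, ?_⟩
  simp only [Finset.sum_mul, smul_mul_assoc, ← hq, smul_sub, Finset.sum_sub_distrib,
    ← Finset.sum_smul, h, zero_smul, sub_zero, rotPoly_apply]
  simp [rotElt]

theorem eq_mul_rotElt_sub_one {p : MonoidAlgebra ℤ (DihedralGroup n)}
    (h : p * rotNorm n = 0) : ∃ q, p = q * (rotElt 1 - 1) := by
  obtain ⟨c, d, rfl⟩ := exists_eq_rotPoly_add 0 p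
  have h0 (e : ZMod n → ℤ) : rotPoly e * rotNorm n = (∑ i, e i) • rotNorm n := by
    rw [rotPoly_apply, Finset.sum_mul, Finset.sum_smul]
    refine Finset.sum_congr rfl fun i _ => ?_
    exact dihedralGroupRing_ext
      (fun k => by simp [MonoidAlgebra.coeff_single_mul_apply, -zsmul_eq_mul])
      (fun k => by simp [-zsmul_eq_mul])
  have h1 : reflElt 0 * rotNorm n = rotNorm n * reflElt 0 :=
    dihedralGroupRing_ext (fun k => by simp) (fun k => by simp)
  rw [add_mul, mul_assoc, h1, ← mul_assoc, h0, h0] at h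
  obtain ⟨q, hq⟩ := exists_rotPoly_eq (c := c) (by
    simpa [-zsmul_eq_mul, -r_zero] using congrArg (fun p => p.coeff (r 0)) h)
  obtain ⟨q', hq'⟩ := exists_rotPoly_eq (c := d) (by
    simpa [-zsmul_eq_mul, -r_zero] using congrArg (fun p => p.coeff (sr 0)) h)
  -- The witness comes from `(x-1)y = -xy(x-1)`.
  refine ⟨q - q' * reflElt (-1), ?_⟩
  rw [hq, hq', sub_mul q, mul_assoc, mul_assoc, sub_mul _ _ (reflElt 0), mul_sub (reflElt _),
    rotElt_mul_reflElt, reflElt_mul_rotElt, one_mul, mul_one, zero_sub, neg_add_cancel,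
    ← neg_sub (reflElt (-1)), mul_neg, sub_neg_eq_add]

theorem eq_zsmul_of_mul_eq {w : MonoidAlgebra ℤ (DihedralGroup n)} (h1 : w * rotElt 1 = w)
    (h2 : w * reflElt 0 = w) : ∃ s : ℤ, w = s • (rotNorm n * (1 + reflElt 0)) := by
  have h3 : ∀ k, w.coeff (r k) = w.coeff (r 0) := fun k =>
    ZMod.apply_eq_of_apply_add_one (c := fun k => w.coeff (r k)) (fun k => by
      have := congrArg (fun p => p.coeff (r (k + 1))) h1
      simpa using this.symm) k 0
  refine ⟨w.coeff (r 0), dihedralGroupRing_ext (fun k => ?_) fun k => ?_⟩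
  · simp [mul_add, h3 k, -zsmul_eq_mul, -r_zero]
  · have := congrArg (fun p => p.coeff (sr k)) h2
    simp only [coeff_mul_reflElt_sr, h3] at this
    simp [mul_add, this, -zsmul_eq_mul, -r_zero]

end Division

/-! ### The kernel of the Fox differential as a pullback -/

section Presentation

variable {n : ℕ} [NeZero n]

theorem foxMatrix_dihedral : foxMatrix (dihedralPresMap n) (dihedralRelators n) =
    !![rotNorm n, -(1 + reflElt 0); 1 + reflElt (-1), rotElt 1 - 1; 0, 1 + reflElt 0] := by
  have hx : dihedralPresMap n (FreeGroup.of 0) = r 1 := by simp [dihedralPresMap]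
  have hy : dihedralPresMap n (FreeGroup.of 1) = sr 0 := by simp [dihedralPresMap]
  refine Matrix.ext fun k i => ?_
  rw [foxMatrix, Matrix.of_apply, foxDeriv_of]
  have hψ (w) : MonoidAlgebra.mapDomainRingHom ℤ (dihedralPresMap n)
      (MonoidAlgebra.of ℤ _ w) = MonoidAlgebra.single (dihedralPresMap n w) 1 := by
    simp
  generalize MonoidAlgebra.mapDomainRingHom ℤ (dihedralPresMap n) = ψ at hψ ⊢
  have hψx (j : ℕ) : ψ (MonoidAlgebra.of ℤ _ (FreeGroup.of 0 ^ j)) = rotElt (j : ZMod n) := by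
    rw [hψ, map_pow, hx, r_one_pow, rotElt]
  have hψx1 : ψ (MonoidAlgebra.of ℤ _ (FreeGroup.of 0)) = rotElt 1 := by rw [hψ, hx, rotElt]
  have hψy : ψ (MonoidAlgebra.of ℤ _ (FreeGroup.of 1)) = reflElt 0 := by rw [hψ, hy, reflElt]
  have hψy' : ψ (MonoidAlgebra.of ℤ _ (FreeGroup.of 1)⁻¹) = reflElt 0 := by
    rw [hψ, map_inv, hy, inv_sr, reflElt]
  have hN : ∑ j ∈ Finset.range n, rotElt (j : ZMod n) = rotNorm n :=
    Finset.sum_nbij' (fun j => (j : ZMod n)) ZMod.val (by simp) (by simp [ZMod.val_lt])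
      (fun j hj => ZMod.val_cast_of_lt (Finset.mem_range.1 hj)) (by simp) (by simp [rotElt])
  have hinv : ((FreeGroup.of 1 : FreeGroup (Fin 2)) ^ (-2 : ℤ)) =
      (FreeGroup.of 1)⁻¹ * (FreeGroup.of 1)⁻¹ := by group
  have h01 : (0 : Fin 2) ≠ 1 := by decide
  fin_cases k <;> fin_cases i <;>
  simp only [dihedralRelators, hinv, Fin.mk_zero, Fin.mk_one, Fin.reduceFinMk,
    Matrix.cons_val_zero, Matrix.cons_val_one, Matrix.cons_val, Matrix.of_apply,
    foxWord_mul, foxWord_pow, foxWord_inv, foxWord_gen, map_add, map_neg, map_one, map_zero,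
    if_true, if_false, h01, h01.symm, mul_zero, mul_one, add_zero, zero_add, neg_zero,
    pow_two, map_mul ψ, map_sum, hψx, hψx1, hψy, hψy', hN, map_mul (MonoidAlgebra.of ℤ _),
    ZMod.natCast_self, neg_add_cancel, rotElt_zero, one_mul, mul_neg, reflElt_mul_reflElt,
    rotElt_mul_reflElt, reflElt_mul_rotElt, sub_self, zero_sub]
  all_goals abel

theorem mem_dihedralKer {v : Fin 3 → MonoidAlgebra ℤ (DihedralGroup n)} :
    v ∈ dihedralKer n ↔ v 0 * rotNorm n + v 1 * (1 + reflElt (-1)) = 0 ∧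
      -(v 0 * (1 + reflElt 0)) + v 1 * (rotElt 1 - 1) + v 2 * (1 + reflElt 0) = 0 := by
  rw [LinearMap.mem_ker, foxD₂, foxMatrix_dihedral, Matrix.vecMulLinear_apply, funext_iff,
    Fin.forall_fin_two]
  simp [Matrix.vecMul, dotProduct, Fin.sum_univ_three, -neg_add_rev, mul_neg]

end Presentation

/-- The module `ker d₂` of the standard presentation of the dihedral group as a pullback. -/
def dihedralKerPullback (n : ℕ) [NeZero n] : DihedralPullback n (dihedralKer n) where
  -- In the coordinates `a = -u₀`, `b = u₂ - u₀ + u₁x`, `c = u₁` the kernel equations become `aN =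
  -- b(1+y) = c(1+xy)`, because `x(1+y) = x + xy`.
  fα := -(LinearMap.proj 0 ∘ₗ (dihedralKer n).subtype)
  fβ :=
    { toFun := fun u => u.1 2 - u.1 0 + u.1 1 * rotElt 1
      map_add' := fun u w => by
        simp only [Submodule.coe_add, Pi.add_apply, add_mul]; abel
      map_smul' := fun p u => by
        simp [mul_add, mul_sub, mul_assoc] }
  fγ := LinearMap.proj 1 ∘ₗ (dihedralKer n).subtype
  α := ⟨![1 - rotElt 1, 0, 1 - rotElt 1], mem_dihedralKer.2 (by
    simp [sub_mul, rotElt_mul_rotNorm])⟩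
  β := ⟨![0, 0, 1 - reflElt 0], mem_dihedralKer.2 (by
    simp [sub_mul, mul_add, reflElt_mul_reflElt, rotElt_zero])⟩
  γ := ⟨![0, 1 - reflElt (-1), reflElt 0 - rotElt 1], mem_dihedralKer.2 (by
    simp [sub_mul, mul_add, mul_sub, reflElt_mul_reflElt, reflElt_mul_rotElt, rotElt_mul_reflElt,
      rotElt_zero])⟩
  δ := ⟨![-(1 + reflElt 0), rotNorm n, -(1 + reflElt 0)], mem_dihedralKer.2 (by
    have h (j : ZMod n) : reflElt j * rotNorm n = rotNorm n * reflElt 0 :=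
      dihedralGroupRing_ext (fun k => by simp) (fun k => by simp)
    have h' (j : ZMod n) : rotNorm n * reflElt j = rotNorm n * reflElt 0 :=
      dihedralGroupRing_ext (fun k => by simp) (fun k => by simp)
    simp only [Matrix.cons_val_zero, Matrix.cons_val_one, Matrix.cons_val]
    rw [neg_mul, add_mul, h, mul_add _ _ (reflElt (-1)), h' (-1), mul_sub, rotNorm_mul_rotElt]
    constructor <;> noncomm_ring)⟩
  fα_α := by simp
  fα_β := by simp
  fα_γ := by simp
  fα_δ := by simp [add_comm]
  fβ_α := by simp
  fβ_β := by simp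
  fβ_γ := by simp [sub_mul, reflElt_mul_rotElt]
  fβ_δ := by simp [rotNorm_mul_rotElt]
  fγ_α := by simp
  fγ_β := by simp
  fγ_γ := by simp
  fγ_δ := by simp
  ext_fα_fβ_fγ := by
    rintro ⟨u, hu⟩ ⟨w, hw⟩ hα hβ hγ
    simp at hα hβ hγ
    rw [hα, hγ] at hβ
    refine Subtype.ext (funext fun i => ?_)
    fin_cases i
    exacts [hα, hγ, by simpa using hβ]
  exists_eq := by
    rintro ⟨u, hu⟩
    obtain ⟨h1, h2⟩ := mem_dihedralKer.1 hu
    have hX : rotElt (1 : ZMod n) * (1 + reflElt 0) = rotElt 1 + reflElt (-1) := by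
      rw [mul_add, mul_one, rotElt_mul_reflElt, zero_sub]
    have hα : -u 0 * rotNorm n = u 1 * (1 + reflElt (-1)) := by
      rw [neg_mul, neg_eq_iff_add_eq_zero, h1]
    have hβ : (u 2 - u 0 + u 1 * rotElt 1) * (1 + reflElt 0) = u 1 * (1 + reflElt (-1)) := by
      rw [add_mul, mul_assoc, hX, ← sub_eq_zero, ← h2]
      noncomm_ring
    -- The common value is right-invariant under `x`, being `aN`, and under `y`, being `b(1+y)`. It
    -- is therefore `s` times the common value for `δ`, and subtracting `sδ` leaves three separate
    -- annihilator conditions.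
    obtain ⟨s, hs⟩ := eq_zsmul_of_mul_eq (w := u 1 * (1 + reflElt (-1)))
      (by rw [← hα, mul_assoc, rotNorm_mul_rotElt])
      (by rw [← hβ, mul_assoc, add_mul (1 : MonoidAlgebra ℤ (DihedralGroup n)),
        reflElt_mul_reflElt, sub_self, rotElt_zero, one_mul,
        add_comm 1])
    have hN (j : ZMod n) : rotNorm n * (1 + reflElt j) = rotNorm n * (1 + reflElt 0) :=
      dihedralGroupRing_ext (fun k => by simp [mul_add]) (fun k => by simp [mul_add])
    have hN' : (1 + reflElt 0) * rotNorm n = rotNorm n * (1 + reflElt 0) :=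
      dihedralGroupRing_ext (fun k => by simp [mul_add, add_mul])
        (fun k => by simp [mul_add, add_mul])
    obtain ⟨p, hp⟩ := eq_mul_rotElt_sub_one (p := -u 0 - s • (1 + reflElt 0)) (by
      rw [sub_mul, smul_mul_assoc, hN', hα, hs, sub_self])
    obtain ⟨q, hq⟩ := eq_mul_one_sub_reflElt 0
      (p := u 2 - u 0 + u 1 * rotElt 1 - s • rotNorm n) (by
        rw [sub_mul, smul_mul_assoc, hβ, hs, sub_self])
    obtain ⟨t, ht⟩ := eq_mul_one_sub_reflElt (-1) (p := u 1 - s • rotNorm n) (by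
      rw [sub_mul, smul_mul_assoc, hN, hs, sub_self])
    have h0 : u 0 = -(s • (1 + reflElt 0)) + p * (1 - rotElt 1) := by
      rw [← neg_sub, mul_neg, ← hp]; abel
    have h1' : u 1 = s • rotNorm n + t * (1 - reflElt (-1)) := by rw [← ht]; abel
    have h2' : u 2 = u 0 - u 1 * rotElt 1 + s • rotNorm n + q * (1 - reflElt 0) := by
      rw [← hq]; abel
    refine ⟨s, p, q, t, Subtype.ext (funext fun i => ?_)⟩
    fin_cases i
    · simp [h0, -zsmul_eq_mul]
    · simp [h1', -zsmul_eq_mul]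
    · simp [h2', h0, h1', -zsmul_eq_mul, add_mul, sub_mul, mul_sub, mul_assoc, rotNorm_mul_rotElt,
        reflElt_mul_rotElt]
      abel

end

theorem theorem4p1 (n : ℕ) [NeZero n] (hn : Even n) :
    tateHomologyZero (WhiteheadGamma.rep (DihedralGroup n) (dihedralKer n)) = ⊥ ∧
      IsAddTorsionFree
        (WhiteheadGamma.rep (DihedralGroup n) (dihedralKer n)).Coinvariants :=
  have := (dihedralKerPullback n).isAddTorsionFree_coinv hn
  ⟨tateHomologyZero_eq_bot _, this⟩
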